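/- Let $\mathsf{Pos}$ be the category of posets and monotone maps, and let $T:\mathsf{Pos}\to\mathsf{Pos}$ be a functor that is finitary (preserves filtered colimits), locally monotone ($f\le g$ pointwise implies $Tf\le Tg$ pointwise), preserves exact squares and preserves finite intersections of order embeddings. (A lax square $fp_0\le gp_1$ with $p_0:P\to A$, $p_1:P\to B$, $f:A\to C$, $g:B\to C$ is exact if $fa\le gb$ implies that some $w\in P$ has $a\le p_0w$ and $p_1w\le b$.) A monotone relation $R:X\nrightarrow Y$ is a relation $R(y,x)$, $y\in Y$, $x\in X$, that is preserved when $y$ decreases and $x$ increases; $(S\cdot R)(z,x)$ holds iff $S(z,y)$ and $R(y,x)$ for some $y$; the negation is a monotone relation $\neg R:X^{op}\nrightarrow Y^{op}$; and $R(-,f-)$ denotes restriction along a monotone map $f$. The lifting $\overline{T}R:TX\nrightarrow TY$ is defined by: $\overline{T}R(\beta,\alpha)$ iff there is $w\in T\{(y,x)\mid R(y,x)\}$ with $\beta\le Tp_0(w)$ and $Tp_1(w)\le\alpha$, where $p_0,p_1$ are the projections of the graph of $R$ (a subposet of $Y\times X$) to $Y$ and $X$. Put $T^\partial X=(TX^{op})^{op}$.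 Let $\mathbb{L}_\omega X$ be the poset of finitely generated lowersets of $X$ ordered by inclusion and $\mathbb{U}_\omega X$ the poset of finitely generated uppersets ordered by reversed inclusion. Let $\not\ni\,:X^{op}\nrightarrow(\mathbb{U}_\omega X)^{op}$ be the negated membership relation; lifting and negating it gives $\neg\overline{T}{\not\ni}:T^\partial X\nrightarrow T^\partial\mathbb{U}_\omega X$. Let $\mathsf{At}$ be a poset and let $\mathcal{L}$ be the algebra for $\mathbb{U}_\omega+\mathbb{L}_\omega+T^\partial+T^\partial$ free on $\mathsf{At}$, with operations $\bigwedge:\mathbb{U}_\omega\mathcal{L}\to\mathcal{L}$, $\bigvee:\mathbb{L}_\omega\mathcal{L}\to\mathcal{L}$ and $\nabla,\Delta:T^\partial\mathcal{L}\to\mathcal{L}$. For a coalgebra $c:X\to TX$ (a monotone map) and a valuation, i.e. a monotone relation $\Vdash_0:\mathsf{At}\nrightarrow X^{op}$, the semantics $\Vdash_c:\mathcal{L}\nrightarrow X^{op}$ is the unique monotone relation extending $\Vdash_0$ such that $x\Vdash\bigwedge\varphi$ iff $x\Vdash a$ for all $a\in\varphi$; $x\Vdash\bigvee\psi$ iff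 $x\Vdash a$ for some $a\in\psi$; $x\Vdash\nabla\alpha$ iff $c(x)\mathrel{\overline{T^\partial}{\Vdash}}\alpha$; and $x\nVdash\Delta\alpha$ iff $c(x)\mathrel{\overline{T}{\nVdash}}\alpha$. Write $a\equiv b$ if $x\Vdash_c a\Leftrightarrow x\Vdash_c b$ for all coalgebras $c:X\to TX$, all valuations and all $x\in X$. For $\beta\in T^\partial\mathcal{L}$ let $\mathsf{base}(\beta)$ be the smallest subposet $W$ of $\mathcal{L}$ (with the induced order) such that $\beta\in T^\partial W$, and let $L_\beta$ be the collection of all $\Phi\in T^\partial\mathbb{U}_\omega\mathsf{base}(\beta)$ with $\Phi\mathrel{\neg\overline{T}{\not\ni}}\beta$ (where $\Phi$ is identified with its image in $T^\partial\mathbb{U}_\omega\mathcal{L}$). **Proposition.** (1) For every coalgebra $c:X\to TX$ and every valuation, the monotone relations ${\Vdash_c}(-,\Delta-)$ and ${\Vdash_c}(-,\nabla(T^\partial\bigwedge)-)\cdot\neg\overline{T}{\not\ni}$ from $T^\partial\mathcal{L}$ to $X^{op}$ are equal. In other words, for all $x\in X$ and $\beta\in T^\partial\mathcal{L}$: $x\Vdash_c\Delta\beta$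 holds if and only if there is $\Phi\in T^\partial\mathbb{U}_\omega\mathcal{L}$ with $\Phi\mathrel{\neg\overline{T}{\not\ni}}\beta$ and $x\Vdash_c\nabla(T^\partial\bigwedge)\Phi$. (2) For every $\beta\in T^\partial\mathcal{L}$ such that $L_\beta$ is finite, $$\Delta\beta\;\equiv\;\bigvee_{\Phi\in L_\beta}\nabla(T^\partial\bigwedge)\Phi .$$ -/

import Mathlib

open CategoryTheory CategoryTheory.Limits

universe u

noncomputable section

namespace MossLogic

/-! ## Monotone relations -/

/-- A monotone relation from `X` to `Y`: a relation `rel y x` that is antitone in `y : Y` and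
monotone in `x : X`, that is, a monotone map `Yᵒᵖ × X → 2`. -/
@[ext]
structure MonRel (X Y : PartOrd.{u}) where
  rel : Y → X → Prop
  mono : ∀ {y y' : Y} {x x' : X}, y' ≤ y → x ≤ x' → rel y x → rel y' x'

namespace MonRel

variable {X Y Z A : PartOrd.{u}}

/-- Composition of monotone relations. -/
def comp (S : MonRel Y Z) (R : MonRel X Y) : MonRel X Z where
  rel z x := ∃ y, S.rel z y ∧ R.rel y x
  mono := fun hz hx ⟨y, h1, h2⟩ => ⟨y, S.mono hz le_rfl h1, R.mono le_rfl hx h2⟩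

/-- The negation `¬R : Xᵒᵖ ⇸ Yᵒᵖ` of a monotone relation `R : X ⇸ Y`. -/
def neg (R : MonRel X Y) : MonRel (PartOrd.dual.obj X) (PartOrd.dual.obj Y) where
  rel y x := ¬ R.rel (OrderDual.ofDual y) (OrderDual.ofDual x)
  mono := fun hy hx h h' => h (R.mono hy hx h')

/-- The restriction `R(-, f-)` of a monotone relation along a monotone map into its domain. -/
def restrict (R : MonRel X Y) (f : A ⟶ X) : MonRel A Y where
  rel y a := R.rel y (f a)
  mono := fun hy hx h => R.mono hy (f.hom.monotone hx) h

/-- The graph `{(y, x) | R y x}` of `R`, a subposet of `Y × X`. -/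
def graph (R : MonRel X Y) : PartOrd.{u} := PartOrd.of {p : Y × X // R.rel p.1 p.2}

/-- The projection of the graph to `Y`. -/
def p0 (R : MonRel X Y) : R.graph ⟶ Y :=
  PartOrd.ofHom ⟨fun p => p.1.1, fun _ _ h => h.1⟩

/-- The projection of the graph to `X`. -/
def p1 (R : MonRel X Y) : R.graph ⟶ X :=
  PartOrd.ofHom ⟨fun p => p.1.2, fun _ _ h => h.2⟩

/-- The relation lifting of `R : X ⇸ Y`, a relation `T X ⇸ T Y`: `β` is related to `α` iff there
is `w ∈ T R` with `β ≤ T p₀ w` and `T p₁ w ≤ α`. -/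
def lift (T : PartOrd.{u} ⥤ PartOrd.{u}) (R : MonRel X Y) : MonRel (T.obj X) (T.obj Y) where
  rel β α := ∃ w : T.obj R.graph, β ≤ T.map R.p0 w ∧ T.map R.p1 w ≤ α
  mono := fun hy hx ⟨w, h1, h2⟩ => ⟨w, hy.trans h1, h2.trans hx⟩

end MonRel

/-! ## Conditions on the coalgebra functor -/

/-- The dual functor, `X ↦ (T Xᵒᵖ)ᵒᵖ`. -/
abbrev dualFunctor (T : PartOrd.{u} ⥤ PartOrd.{u}) : PartOrd.{u} ⥤ PartOrd.{u} :=
  PartOrd.dual ⋙ T ⋙ PartOrd.dual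

/-- `T` is locally monotone: `f ≤ g` pointwise implies `T f ≤ T g` pointwise. -/
def LocallyMonotone (T : PartOrd.{u} ⥤ PartOrd.{u}) : Prop :=
  ∀ ⦃X Y : PartOrd.{u}⦄ (f g : X ⟶ Y), (∀ x, f x ≤ g x) → ∀ z, T.map f z ≤ T.map g z

/-- A lax square `f ∘ p₀ ≤ g ∘ p₁` is exact if `f a ≤ g b` entails the existence of `w` with
`a ≤ p₀ w` and `p₁ w ≤ b`. -/
structure IsExactSquare {P A B C : PartOrd.{u}} (p₀ : P ⟶ A) (p₁ : P ⟶ B) (f : A ⟶ C)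
    (g : B ⟶ C) : Prop where
  lax : ∀ w, f (p₀ w) ≤ g (p₁ w)
  exact_of_le : ∀ a b, f a ≤ g b → ∃ w, a ≤ p₀ w ∧ p₁ w ≤ b

/-- The Beck-Chevalley condition: `T` preserves exact squares. -/
def PreservesExactSquares (T : PartOrd.{u} ⥤ PartOrd.{u}) : Prop :=
  ∀ ⦃P A B C : PartOrd.{u}⦄ (p₀ : P ⟶ A) (p₁ : P ⟶ B) (f : A ⟶ C) (g : B ⟶ C),
    IsExactSquare p₀ p₁ f g → IsExactSquare (T.map p₀) (T.map p₁) (T.map f) (T.map g)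

/-- A monotone map that reflects the order. -/
def IsOrderEmb {X Y : PartOrd.{u}} (m : X ⟶ Y) : Prop := ∀ a b, m a ≤ m b → a ≤ b

/-- `T` preserves (binary) intersections, i.e. pullbacks, of order embeddings. -/
def PreservesIntersections (T : PartOrd.{u} ⥤ PartOrd.{u}) : Prop :=
  ∀ ⦃P A B C : PartOrd.{u}⦄ (p : P ⟶ A) (q : P ⟶ B) (m : A ⟶ C) (n : B ⟶ C),
    IsOrderEmb m → IsOrderEmb n → IsPullback p q m n →
      IsPullback (T.map p) (T.map q) (T.map m) (T.map n)

/-- The standing assumptions on the coalgebra functor: it is finitary (preserves filtered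
colimits), locally monotone, and preserves exact squares and finite intersections of order
embeddings. -/
structure Admissible (T : PartOrd.{u} ⥤ PartOrd.{u}) : Prop where
  finitary : PreservesFilteredColimitsOfSize.{u, u} T
  locallyMonotone : LocallyMonotone T
  exactSquares : PreservesExactSquares T
  intersections : PreservesIntersections T

/-! ## Finitely generated lowersets and uppersets -/

/-- Finitely generated lowersets of `X`, ordered by inclusion. -/
abbrev FinLower (X : PartOrd.{u}) : PartOrd.{u} :=
  PartOrd.of {l : LowerSet X // ∃ s : Set X, s.Finite ∧ l = lowerClosure s}

/-- Finitely generated uppersets of `X`, ordered by reversed inclusion (this is Mathlib's order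
on `UpperSet`). -/
abbrev FinUpper (X : PartOrd.{u}) : PartOrd.{u} :=
  PartOrd.of {l : UpperSet X // ∃ s : Set X, s.Finite ∧ l = upperClosure s}

/-- The lowerset generated by a finite set. -/
def finLower {X : PartOrd.{u}} (s : Set X) (hs : s.Finite) : FinLower X :=
  ⟨lowerClosure s, s, hs, rfl⟩

theorem lowerClosure_image_lowerClosure {X Y : PartOrd.{u}} (f : X ⟶ Y) (s : Set X) :
    lowerClosure (f '' (lowerClosure s : Set X)) = lowerClosure (f '' s) := by
  apply le_antisymm
  · rw [lowerClosure_le]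
    rintro _ ⟨x, ⟨a, ha, hxa⟩, rfl⟩
    exact ⟨f a, ⟨a, ha, rfl⟩, f.hom.monotone hxa⟩
  · exact lowerClosure_mono (Set.image_mono subset_lowerClosure)

theorem upperClosure_image_upperClosure {X Y : PartOrd.{u}} (f : X ⟶ Y) (s : Set X) :
    upperClosure (f '' (upperClosure s : Set X)) = upperClosure (f '' s) := by
  apply le_antisymm
  · exact upperClosure_anti (Set.image_mono subset_upperClosure)
  · rw [le_upperClosure]
    rintro _ ⟨x, ⟨a, ha, hxa⟩, rfl⟩
    exact ⟨f a, ⟨a, ha, rfl⟩, f.hom.monotone hxa⟩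

/-- The finitary lowerset functor: a map `f` sends `l` to the lowerset generated by `f[l]`. -/
def Lω : PartOrd.{u} ⥤ PartOrd.{u} where
  obj X := FinLower X
  map {X Y} f := PartOrd.ofHom
    { toFun := fun l => ⟨lowerClosure (f '' (l.1 : Set X)), by
        obtain ⟨_, s, hs, rfl⟩ := l
        exact ⟨f '' s, hs.image f, lowerClosure_image_lowerClosure f s⟩⟩
      monotone' := fun _ _ h => lowerClosure_mono (Set.image_mono h) }
  map_id X := by
    refine PartOrd.ext fun l => Subtype.ext ?_
    change lowerClosure ((fun x => x) '' (l.1 : Set X)) = l.1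
    simp
  map_comp {X Y Z} f g := by
    refine PartOrd.ext fun l => Subtype.ext ?_
    change lowerClosure ((f ≫ g) '' (l.1 : Set X)) =
      lowerClosure (g '' (lowerClosure (f '' (l.1 : Set X)) : Set Y))
    rw [lowerClosure_image_lowerClosure, PartOrd.coe_comp, Set.image_comp]

/-- The finitary upperset functor: a map `f` sends `l` to the upperset generated by `f[l]`. -/
def Uω : PartOrd.{u} ⥤ PartOrd.{u} where
  obj X := FinUpper X
  map {X Y} f := PartOrd.ofHom
    { toFun := fun l => ⟨upperClosure (f '' (l.1 : Set X)), by
        obtain ⟨_, s, hs, rfl⟩ := l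
        exact ⟨f '' s, hs.image f, upperClosure_image_upperClosure f s⟩⟩
      monotone' := fun _ _ h => upperClosure_anti (Set.image_mono h) }
  map_id X := by
    refine PartOrd.ext fun l => Subtype.ext ?_
    change upperClosure ((fun x => x) '' (l.1 : Set X)) = l.1
    simp
  map_comp {X Y Z} f g := by
    refine PartOrd.ext fun l => Subtype.ext ?_
    change upperClosure ((f ≫ g) '' (l.1 : Set X)) =
      upperClosure (g '' (upperClosure (f '' (l.1 : Set X)) : Set Y))
    rw [upperClosure_image_upperClosure, PartOrd.coe_comp, Set.image_comp]

/-- The membership relation `X ⇸ U_ω X`. -/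
def sqni (X : PartOrd.{u}) : MonRel X (Uω.obj X) where
  rel v a := a ∈ v.1
  mono := fun hu ha h => UpperSet.upper _ ha (hu h)

/-! ## Bases -/

/-- The order embedding of a subset of `X`, with the induced order, into `X`. -/
def incl {X : PartOrd.{u}} (S : Set X) : PartOrd.of S ⟶ X :=
  PartOrd.ofHom ⟨Subtype.val, fun _ _ h => h⟩

/-- `W` is a base of `α ∈ F X`: for all subobjects `S` of `X`, `W ⊆ S` iff `α ∈ F S`. -/
def IsBase (F : PartOrd.{u} ⥤ PartOrd.{u}) {X : PartOrd.{u}} (α : F.obj X) (W : Set X) : Prop :=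
  ∀ S : Set X, W ⊆ S ↔ α ∈ Set.range (F.map (incl S))

/-- The base of `α ∈ F X`, the intersection of all subobjects `S` of `X` with `α ∈ F S`. -/
def base (F : PartOrd.{u} ⥤ PartOrd.{u}) {X : PartOrd.{u}} (α : F.obj X) : Set X :=
  ⋂₀ {S | α ∈ Set.range (F.map (incl S))}

theorem IsBase.eq_base {F : PartOrd.{u} ⥤ PartOrd.{u}} {X : PartOrd.{u}} {α : F.obj X} {W : Set X}
    (h : IsBase F α W) : W = base F α :=
  Set.Subset.antisymm (Set.subset_sInter fun S hS => (h S).2 hS)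
    (Set.sInter_subset_of_mem ((h W).1 subset_rfl))

/-! ## The language -/

/-- An algebra for the functor `U_ω + L_ω + T^∂ + T^∂`, given by its components `⋀, ⋁, ∇, Δ`. -/
structure LangAlg (T : PartOrd.{u} ⥤ PartOrd.{u}) where
  carrier : PartOrd.{u}
  conj : Uω.obj carrier ⟶ carrier
  disj : Lω.obj carrier ⟶ carrier
  nabla : (dualFunctor T).obj carrier ⟶ carrier
  delta : (dualFunctor T).obj carrier ⟶ carrier

/-- Homomorphisms of such algebras. -/
structure LangAlg.IsHom {T : PartOrd.{u} ⥤ PartOrd.{u}} (A B : LangAlg T)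
    (h : A.carrier ⟶ B.carrier) : Prop where
  conj : Uω.map h ≫ B.conj = A.conj ≫ h
  disj : Lω.map h ≫ B.disj = A.disj ≫ h
  nabla : (dualFunctor T).map h ≫ B.nabla = A.nabla ≫ h
  delta : (dualFunctor T).map h ≫ B.delta = A.delta ≫ h

/-- `A` is free on `At` with unit `i`. -/
def LangAlg.IsFreeOn {T : PartOrd.{u} ⥤ PartOrd.{u}} (A : LangAlg T) {At : PartOrd.{u}}
    (i : At ⟶ A.carrier) : Prop :=
  ∀ (B : LangAlg T) (g : At ⟶ B.carrier), ∃! h : A.carrier ⟶ B.carrier, A.IsHom B h ∧ i ≫ h = g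

/-! ## Existence of free algebras

The free algebra is the colimit of the chain `∅ → G ∅ → G (G ∅) → ⋯` for
`G = At + (U_ω + (L_ω + (T^∂ + T^∂)))`. -/

section Chain

variable {W : ℕ ⥤ PartOrd.{u}}

/-- A concrete description of colimits of `ω`-chains of posets. -/
structure IsSeqColim (t : Cocone W) : Prop where
  surj : ∀ y : t.pt, ∃ n, ∃ a : W.obj n, t.ι.app n a = y
  refl : ∀ n (a b : W.obj n), t.ι.app n a ≤ t.ι.app n b →
    ∃ m, ∃ h : n ≤ m, W.map (homOfLE h) a ≤ W.map (homOfLE h) b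

theorem cocone_w (t : Cocone W) {n m : ℕ} (h : n ≤ m) (a : W.obj n) :
    t.ι.app m (W.map (homOfLE h) a) = t.ι.app n a := by
  rw [← PartOrd.comp_apply, t.w]

theorem chain_map_map {n m k : ℕ} (h : n ≤ m) (h' : m ≤ k) (a : W.obj n) :
    W.map (homOfLE h') (W.map (homOfLE h) a) = W.map (homOfLE (h.trans h')) a := by
  rw [← PartOrd.comp_apply, ← W.map_comp]; rfl

theorem IsSeqColim.le_of_le {t : Cocone W} (ht : IsSeqColim t) (s : Cocone W) {n m : ℕ}
    {a : W.obj n} {b : W.obj m} (h : t.ι.app n a ≤ t.ι.app m b) :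
    s.ι.app n a ≤ s.ι.app m b := by
  rw [← cocone_w t (le_max_left n m), ← cocone_w t (le_max_right n m)] at h
  obtain ⟨k, hk, h⟩ := ht.refl _ _ _ h
  have := (s.ι.app k).hom.monotone h
  erw [cocone_w s, cocone_w s, cocone_w s, cocone_w s] at this
  exact this

/-- Such cocones are colimits. -/
def IsSeqColim.isColimit {t : Cocone W} (ht : IsSeqColim t) : IsColimit t where
  desc s := PartOrd.ofHom
    { toFun := fun y => s.ι.app (ht.surj y).choose (ht.surj y).choose_spec.choose
      monotone' := fun y z h => ht.le_of_le s (by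
        rwa [(ht.surj y).choose_spec.choose_spec, (ht.surj z).choose_spec.choose_spec]) }
  fac s n := by
    refine PartOrd.ext fun a => ?_
    set y := t.ι.app n a with hy
    apply le_antisymm
    · exact ht.le_of_le s (ht.surj y).choose_spec.choose_spec.le
    · exact ht.le_of_le s (ht.surj y).choose_spec.choose_spec.ge
  uniq s f hf := by
    refine PartOrd.ext fun y => ?_
    change f y = s.ι.app (ht.surj y).choose (ht.surj y).choose_spec.choose
    rw [← hf, PartOrd.comp_apply, (ht.surj y).choose_spec.choose_spec]

/-- The disjoint union of the stages of a chain. -/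
def ChainSum (W : ℕ ⥤ PartOrd.{u}) : Type u := Σ n, W.obj n

/-- The preorder on the disjoint union of the stages of a chain. -/
instance chainPreorder (W : ℕ ⥤ PartOrd.{u}) : Preorder (ChainSum W) where
  le p q := ∃ k, ∃ (h : p.1 ≤ k) (h' : q.1 ≤ k), W.map (homOfLE h) p.2 ≤ W.map (homOfLE h') q.2
  lt p q := (∃ k, ∃ (h : p.1 ≤ k) (h' : q.1 ≤ k),
      W.map (homOfLE h) p.2 ≤ W.map (homOfLE h') q.2) ∧
    ¬ ∃ k, ∃ (h : q.1 ≤ k) (h' : p.1 ≤ k), W.map (homOfLE h) q.2 ≤ W.map (homOfLE h') p.2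
  le_refl p := ⟨p.1, le_rfl, le_rfl, le_rfl⟩
  le_trans := by
    rintro p q r ⟨k, h1, h2, h3⟩ ⟨l, h4, h5, h6⟩
    refine ⟨max k l, h1.trans (le_max_left _ _), h5.trans (le_max_right _ _), ?_⟩
    have a1 := (W.map (homOfLE (le_max_left k l))).hom.monotone h3
    have a2 := (W.map (homOfLE (le_max_right k l))).hom.monotone h6
    erw [chain_map_map, chain_map_map] at a1 a2
    exact a1.trans a2
  lt_iff_le_not_ge _ _ := Iff.rfl

/-- The colimit of a chain of posets. -/
def chainCocone (W : ℕ ⥤ PartOrd.{u}) : Cocone W :=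
  { pt := PartOrd.of (Antisymmetrization (ChainSum W) (· ≤ ·))
    ι :=
      { app := fun n => PartOrd.ofHom
          { toFun := fun a => toAntisymmetrization (· ≤ ·) (⟨n, a⟩ : ChainSum W)
            monotone' := fun a b h => by
              refine toAntisymmetrization_le_toAntisymmetrization_iff.2 ?_
              exact ⟨n, le_rfl, le_rfl, (W.map _).hom.monotone h⟩ }
        naturality := fun n m f => by
          refine PartOrd.ext fun a => ?_
          refine Quotient.sound ⟨?_, ?_⟩
          · exact ⟨m, le_rfl, leOfHom f, (chain_map_map (leOfHom f) le_rfl a).le⟩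
          · exact ⟨m, leOfHom f, le_rfl, (chain_map_map (leOfHom f) le_rfl a).ge⟩ } }

theorem isSeqColim_chainCocone (W : ℕ ⥤ PartOrd.{u}) : IsSeqColim (chainCocone W) where
  surj y := by
    induction y using Quotient.inductionOn' with
    | h p => exact ⟨p.1, p.2, rfl⟩
  refl n a b h := by
    obtain ⟨k, h1, _, h3⟩ := h
    exact ⟨k, h1, h3⟩

theorem isSeqColim_of_isColimit {t : Cocone W} (ht : IsColimit t) : IsSeqColim t := by
  let e := ht.coconePointUniqueUpToIso (isSeqColim_chainCocone W).isColimit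
  have he : ∀ n (a : W.obj n), e.hom (t.ι.app n a) = (chainCocone W).ι.app n a := fun n a => by
    rw [← PartOrd.comp_apply, IsColimit.comp_coconePointUniqueUpToIso_hom]
  constructor
  · intro y
    obtain ⟨n, a, h⟩ := (isSeqColim_chainCocone W).surj (e.hom y)
    refine ⟨n, a, ?_⟩
    rw [← he] at h
    have := congrArg e.inv h
    simpa using this
  · intro n a b h
    apply (isSeqColim_chainCocone W).refl
    rw [← he, ← he]
    exact e.hom.hom.monotone h

end Chain

/-- `F` preserves colimits of `ω`-chains. -/
def PreservesChains (F : PartOrd.{u} ⥤ PartOrd.{u}) : Prop :=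
  ∀ (W : ℕ ⥤ PartOrd.{u}) (t : Cocone W), IsSeqColim t → IsSeqColim (F.mapCocone t)

theorem preservesChains_dualFunctor {T : PartOrd.{u} ⥤ PartOrd.{u}}
    (hT : PreservesFilteredColimitsOfSize.{u, u} T) : PreservesChains (dualFunctor T) := by
  intro W t ht
  have : PreservesFilteredColimitsOfSize.{0, 0} T := preservesFilteredColimitsOfSize_shrink T
  have : PreservesColimitsOfShape ℕ T :=
    PreservesFilteredColimitsOfSize.preserves_filtered_colimits ℕ
  have : PartOrd.dual.{u}.IsEquivalence := PartOrd.dualEquiv.isEquivalence_functor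
  exact isSeqColim_of_isColimit (isColimitOfPreserves (dualFunctor T) ht.isColimit)

theorem preservesChains_const (A : PartOrd.{u}) :
    PreservesChains ((Functor.const PartOrd.{u}).obj A) := fun _ _ _ =>
  ⟨fun y => ⟨0, y, rfl⟩, fun n _ _ h => ⟨n, le_rfl, h⟩⟩

/-- The disjoint sum of two endofunctors of posets. -/
def sumFunctor (F G : PartOrd.{u} ⥤ PartOrd.{u}) : PartOrd.{u} ⥤ PartOrd.{u} where
  obj X := PartOrd.of (F.obj X ⊕ G.obj X)
  map f := PartOrd.ofHom ⟨Sum.map (F.map f) (G.map f), by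
    rintro _ _ (⟨h⟩ | ⟨h⟩)
    · exact Sum.inl_mono ((F.map f).hom.monotone h)
    · exact Sum.inr_mono ((G.map f).hom.monotone h)⟩
  map_id X := by
    refine PartOrd.ext fun x => ?_
    change Sum.map (F.map (𝟙 X)) (G.map (𝟙 X)) x = x
    rcases x with x | x <;> simp
  map_comp f g := by
    refine PartOrd.ext fun x => ?_
    change Sum.map (F.map (f ≫ g)) (G.map (f ≫ g)) x =
      Sum.map (F.map g) (G.map g) (Sum.map (F.map f) (G.map f) x)
    rcases x with x | x <;> simp

theorem preservesChains_sumFunctor {F G : PartOrd.{u} ⥤ PartOrd.{u}} (hF : PreservesChains F)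
    (hG : PreservesChains G) : PreservesChains (sumFunctor F G) := by
  intro W t ht
  constructor
  · rintro (y | y)
    · obtain ⟨n, a, h⟩ := (hF W t ht).surj y
      exact ⟨n, Sum.inl a, congrArg Sum.inl h⟩
    · obtain ⟨n, a, h⟩ := (hG W t ht).surj y
      exact ⟨n, Sum.inr a, congrArg Sum.inr h⟩
  · rintro n (a | a) (b | b) h
    · obtain ⟨m, hm, h⟩ := (hF W t ht).refl n a b (Sum.inl_le_inl_iff.1 h)
      exact ⟨m, hm, Sum.inl_le_inl_iff.2 h⟩
    · exact (Sum.not_inl_le_inr h).elim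
    · exact (Sum.not_inr_le_inl h).elim
    · obtain ⟨m, hm, h⟩ := (hG W t ht).refl n a b (Sum.inr_le_inr_iff.1 h)
      exact ⟨m, hm, Sum.inr_le_inr_iff.2 h⟩

/-- A finite set of elements of the colimit of a chain comes from one stage. -/
theorem IsSeqColim.finite_lift {W : ℕ ⥤ PartOrd.{u}} {t : Cocone W} (ht : IsSeqColim t)
    {s : Set t.pt} (hs : s.Finite) :
    ∃ n, ∃ r : Set (W.obj n), r.Finite ∧ t.ι.app n '' r = s := by
  induction s, hs using Set.Finite.induction_on with
  | empty => exact ⟨0, ∅, Set.finite_empty, Set.image_empty _⟩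
  | @insert y s _ _ ih =>
    obtain ⟨n, r, hr, rfl⟩ := ih
    obtain ⟨m, a, rfl⟩ := ht.surj y
    refine ⟨max n m, insert (W.map (homOfLE (le_max_right n m)) a)
      (W.map (homOfLE (le_max_left n m)) '' r), (hr.image _).insert _, ?_⟩
    rw [Set.image_insert_eq, cocone_w, Set.image_image]
    simp only [cocone_w]

/-- Finitely many inequalities that hold in the colimit of a chain hold at one later stage. -/
theorem IsSeqColim.finite_refl {W : ℕ ⥤ PartOrd.{u}} {t : Cocone W} (ht : IsSeqColim t) {n : ℕ}
    {s : Set (W.obj n × W.obj n)} (hs : s.Finite)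
    (h : ∀ p ∈ s, t.ι.app n p.1 ≤ t.ι.app n p.2) :
    ∃ m, ∃ hm : n ≤ m, ∀ p ∈ s, W.map (homOfLE hm) p.1 ≤ W.map (homOfLE hm) p.2 := by
  induction s, hs using Set.Finite.induction_on with
  | empty => exact ⟨n, le_rfl, by simp⟩
  | @insert q s _ _ ih =>
    obtain ⟨m, hm, h1⟩ := ih fun p hp => h p (Set.mem_insert_of_mem _ hp)
    obtain ⟨k, hk, h2⟩ := ht.refl n q.1 q.2 (h q (Set.mem_insert _ _))
    refine ⟨max m k, hm.trans (le_max_left _ _), ?_⟩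
    rintro p (rfl | hp)
    · have := (W.map (homOfLE (le_max_right m k))).hom.monotone h2
      erw [chain_map_map, chain_map_map] at this
      exact this
    · have := (W.map (homOfLE (le_max_left m k))).hom.monotone (h1 p hp)
      erw [chain_map_map, chain_map_map] at this
      exact this

theorem preservesChains_Lω : PreservesChains Lω.{u} := by
  intro W t ht
  constructor
  · rintro ⟨_, s, hs, rfl⟩
    obtain ⟨n, r, hr, rfl⟩ := ht.finite_lift hs
    exact ⟨n, ⟨lowerClosure r, r, hr, rfl⟩, Subtype.ext (lowerClosure_image_lowerClosure _ _)⟩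
  · rintro n ⟨_, r, hr, rfl⟩ ⟨_, q, hq, rfl⟩ h
    change lowerClosure (t.ι.app n '' (lowerClosure r : Set (W.obj n))) ≤
      lowerClosure (t.ι.app n '' (lowerClosure q : Set (W.obj n))) at h
    rw [lowerClosure_image_lowerClosure, lowerClosure_image_lowerClosure, lowerClosure_le] at h
    have h' : ∀ a ∈ r, ∃ b ∈ q, t.ι.app n a ≤ t.ι.app n b := fun a ha => by
      obtain ⟨_, ⟨b, hb, rfl⟩, hab⟩ := h ⟨a, ha, rfl⟩
      exact ⟨b, hb, hab⟩
    choose! g hg hg' using h'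
    obtain ⟨m, hm, h1⟩ := ht.finite_refl (hr.image fun a => (a, g a))
      (by rintro _ ⟨a, ha, rfl⟩; exact hg' a ha)
    refine ⟨m, hm, ?_⟩
    change lowerClosure (W.map (homOfLE hm) '' (lowerClosure r : Set (W.obj n))) ≤
      lowerClosure (W.map (homOfLE hm) '' (lowerClosure q : Set (W.obj n)))
    rw [lowerClosure_image_lowerClosure, lowerClosure_image_lowerClosure, lowerClosure_le]
    rintro _ ⟨a, ha, rfl⟩
    exact ⟨_, ⟨g a, hg a ha, rfl⟩, h1 _ ⟨a, ha, rfl⟩⟩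

theorem preservesChains_Uω : PreservesChains Uω.{u} := by
  intro W t ht
  constructor
  · rintro ⟨_, s, hs, rfl⟩
    obtain ⟨n, r, hr, rfl⟩ := ht.finite_lift hs
    exact ⟨n, ⟨upperClosure r, r, hr, rfl⟩, Subtype.ext (upperClosure_image_upperClosure _ _)⟩
  · rintro n ⟨_, q, hq, rfl⟩ ⟨_, r, hr, rfl⟩ h
    change upperClosure (t.ι.app n '' (upperClosure q : Set (W.obj n))) ≤
      upperClosure (t.ι.app n '' (upperClosure r : Set (W.obj n))) at h
    rw [upperClosure_image_upperClosure, upperClosure_image_upperClosure, le_upperClosure] at h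
    have h' : ∀ a ∈ r, ∃ b ∈ q, t.ι.app n b ≤ t.ι.app n a := fun a ha => by
      obtain ⟨_, ⟨b, hb, rfl⟩, hab⟩ := h ⟨a, ha, rfl⟩
      exact ⟨b, hb, hab⟩
    choose! g hg hg' using h'
    obtain ⟨m, hm, h1⟩ := ht.finite_refl (hr.image fun a => (g a, a))
      (by rintro _ ⟨a, ha, rfl⟩; exact hg' a ha)
    refine ⟨m, hm, ?_⟩
    change upperClosure (W.map (homOfLE hm) '' (upperClosure q : Set (W.obj n))) ≤
      upperClosure (W.map (homOfLE hm) '' (upperClosure r : Set (W.obj n)))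
    rw [upperClosure_image_upperClosure, upperClosure_image_upperClosure, le_upperClosure]
    rintro _ ⟨a, ha, rfl⟩
    exact ⟨_, ⟨g a, hg a ha, rfl⟩, h1 _ ⟨a, ha, rfl⟩⟩

section Iterate

variable (G : PartOrd.{u} ⥤ PartOrd.{u})

/-- The stages of the initial chain of `G`. -/
def stage : ℕ → PartOrd.{u}
  | 0 => PartOrd.of PEmpty
  | n + 1 => G.obj (stage n)

/-- The connecting maps of the initial chain of `G`. -/
def stageMap : ∀ n, stage G n ⟶ stage G (n + 1)
  | 0 => PartOrd.ofHom ⟨fun x => x.elim, fun x => x.elim⟩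
  | n + 1 => G.map (stageMap n)

variable {G}

/-- The maps from the initial chain of `G` to an algebra. -/
def stageDesc {B : PartOrd.{u}} (β : G.obj B ⟶ B) : ∀ n, stage G n ⟶ B
  | 0 => PartOrd.ofHom ⟨fun x => x.elim, fun x => x.elim⟩
  | n + 1 => G.map (stageDesc β n) ≫ β

theorem stageMap_desc {B : PartOrd.{u}} (β : G.obj B ⟶ B) (n : ℕ) :
    stageMap G n ≫ stageDesc β (n + 1) = stageDesc β n := by
  induction n with
  | zero => exact PartOrd.ext fun x => x.elim
  | succ n ih =>
    change G.map (stageMap G n) ≫ G.map (stageDesc β (n + 1)) ≫ β = G.map (stageDesc β n) ≫ β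
    rw [← ih, G.map_comp, Category.assoc]

/-- An endofunctor that preserves colimits of chains has an initial algebra. -/
theorem exists_initial_algebra (hG : PreservesChains G) :
    ∃ (L : PartOrd.{u}) (α : G.obj L ⟶ L), ∀ (B : PartOrd.{u}) (β : G.obj B ⟶ B),
      ∃! h : L ⟶ B, G.map h ≫ β = α ≫ h := by
  let W := Functor.ofSequence (stageMap G)
  have hW : ∀ n, W.map (homOfLE (Nat.le_succ n)) = stageMap G n :=
    Functor.ofSequence_map_homOfLE_succ (stageMap G)
  let t := chainCocone W
  have ht : IsColimit t := (isSeqColim_chainCocone W).isColimit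
  have hGt : IsColimit (G.mapCocone t) := (hG W t (isSeqColim_chainCocone W)).isColimit
  let leg : ∀ n, stage G n ⟶ t.pt := fun n => t.ι.app n
  have hleg : ∀ n, stageMap G n ≫ leg (n + 1) = leg n := fun n => by
    rw [← hW]; exact t.w _
  let s : Cocone (W ⋙ G) :=
    { pt := t.pt
      ι := NatTrans.ofSequence (F := W ⋙ G) (G := (Functor.const ℕ).obj t.pt)
        (fun n => leg (n + 1)) (fun n => by
          have : (W ⋙ G).map (homOfLE (n.le_add_right 1)) = stageMap G (n + 1) := by
            change G.map (W.map (homOfLE (Nat.le_succ n))) = _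
            rw [hW]; rfl
          rw [this]
          change stageMap G (n + 1) ≫ leg (n + 1 + 1) = leg (n + 1) ≫ 𝟙 _
          rw [hleg, Category.comp_id]) }
  let α : G.obj t.pt ⟶ t.pt := hGt.desc s
  have hα : ∀ n, G.map (leg n) ≫ α = leg (n + 1) := fun n => hGt.fac s n
  refine ⟨t.pt, α, fun B β => ?_⟩
  let r : Cocone W :=
    { pt := B
      ι := NatTrans.ofSequence (F := W) (G := (Functor.const ℕ).obj B)
        (fun n => stageDesc β n) (fun n => by
          have : W.map (homOfLE (n.le_add_right 1)) = stageMap G n := hW n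
          rw [this]
          change stageMap G n ≫ stageDesc β (n + 1) = stageDesc β n ≫ 𝟙 _
          rw [stageMap_desc, Category.comp_id]) }
  have hr : ∀ n, leg n ≫ ht.desc r = stageDesc β n := fun n => ht.fac r n
  refine ⟨ht.desc r, ?_, fun h hh => ?_⟩
  · refine hGt.hom_ext fun n => ?_
    change G.map (leg n) ≫ G.map (ht.desc r) ≫ β = G.map (leg n) ≫ α ≫ ht.desc r
    rw [← Category.assoc, ← G.map_comp, hr, ← Category.assoc, hα]
    exact (hr (n + 1)).symm
  · refine ht.hom_ext fun n => ?_
    change leg n ≫ h = leg n ≫ ht.desc r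
    rw [hr]
    induction n with
    | zero => exact PartOrd.ext fun x => x.elim
    | succ n ih =>
      have h1 : (G.map (leg n) ≫ α) ≫ h = G.map (stageDesc β n) ≫ β := by
        rw [Category.assoc, ← hh, ← Category.assoc, ← G.map_comp, ih]
      rw [hα] at h1
      exact h1

end Iterate

/-- For finitary `T`, free algebras exist. -/
theorem exists_isFreeOn {T : PartOrd.{u} ⥤ PartOrd.{u}}
    (hT : PreservesFilteredColimitsOfSize.{u, u} T) (At : PartOrd.{u}) :
    ∃ (A : LangAlg T) (i : At ⟶ A.carrier), A.IsFreeOn i := by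
  have hD := preservesChains_dualFunctor hT
  obtain ⟨L, α, hα⟩ := exists_initial_algebra
    (preservesChains_sumFunctor (preservesChains_const At) (preservesChains_sumFunctor
      preservesChains_Uω (preservesChains_sumFunctor preservesChains_Lω
        (preservesChains_sumFunctor hD hD))))
  refine ⟨⟨L, PartOrd.ofHom ⟨fun z => α (Sum.inr (Sum.inl z)), ?_⟩,
    PartOrd.ofHom ⟨fun z => α (Sum.inr (Sum.inr (Sum.inl z))), ?_⟩,
    PartOrd.ofHom ⟨fun z => α (Sum.inr (Sum.inr (Sum.inr (Sum.inl z)))), ?_⟩,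
    PartOrd.ofHom ⟨fun z => α (Sum.inr (Sum.inr (Sum.inr (Sum.inr z)))), ?_⟩⟩,
    PartOrd.ofHom ⟨fun z => α (Sum.inl z), ?_⟩, fun B g => ?_⟩
  · exact fun _ _ h => α.hom.monotone (Sum.inr_mono (Sum.inl_mono h))
  · exact fun _ _ h => α.hom.monotone (Sum.inr_mono (Sum.inr_mono (Sum.inl_mono h)))
  · exact fun _ _ h =>
      α.hom.monotone (Sum.inr_mono (Sum.inr_mono (Sum.inr_mono (Sum.inl_mono h))))
  · exact fun _ _ h =>
      α.hom.monotone (Sum.inr_mono (Sum.inr_mono (Sum.inr_mono (Sum.inr_mono h))))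
  · exact fun _ _ h => α.hom.monotone (Sum.inl_mono h)
  · obtain ⟨h, hh, huniq⟩ := hα B.carrier (PartOrd.ofHom
      ⟨Sum.elim g (Sum.elim B.conj (Sum.elim B.disj (Sum.elim B.nabla B.delta))), by
        rintro _ _ (⟨h⟩ | ⟨⟨h⟩ | ⟨⟨h⟩ | ⟨⟨h⟩ | ⟨h⟩⟩⟩⟩)
        · exact g.hom.monotone h
        · exact B.conj.hom.monotone h
        · exact B.disj.hom.monotone h
        · exact B.nabla.hom.monotone h
        · exact B.delta.hom.monotone h⟩)
    have hx := fun x => ConcreteCategory.congr_hom hh x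
    refine ⟨h, ⟨⟨PartOrd.ext fun z => hx (Sum.inr (Sum.inl z)),
      PartOrd.ext fun z => hx (Sum.inr (Sum.inr (Sum.inl z))),
      PartOrd.ext fun z => hx (Sum.inr (Sum.inr (Sum.inr (Sum.inl z)))),
      PartOrd.ext fun z => hx (Sum.inr (Sum.inr (Sum.inr (Sum.inr z))))⟩,
      PartOrd.ext fun z => (hx (Sum.inl z)).symm⟩, ?_⟩
    rintro k ⟨hk, hk'⟩
    apply huniq
    refine PartOrd.ext ?_
    rintro (z | z | z | z | z)
    · exact (ConcreteCategory.congr_hom hk' z).symm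
    · exact ConcreteCategory.congr_hom hk.conj z
    · exact ConcreteCategory.congr_hom hk.disj z
    · exact ConcreteCategory.congr_hom hk.nabla z
    · exact ConcreteCategory.congr_hom hk.delta z

/-- The language: the algebra for `U_ω + L_ω + T^∂ + T^∂` free on the poset `At` of atoms. -/
def Lang {T : PartOrd.{u} ⥤ PartOrd.{u}} (hT : Admissible T) (At : PartOrd.{u}) : LangAlg T :=
  (exists_isFreeOn hT.finitary At).choose

/-- The atomic formulas. -/
def atom {T : PartOrd.{u} ⥤ PartOrd.{u}} (hT : Admissible T) (At : PartOrd.{u}) :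
    At ⟶ (Lang hT At).carrier :=
  (exists_isFreeOn hT.finitary At).choose_spec.choose

theorem isFreeOn_atom {T : PartOrd.{u} ⥤ PartOrd.{u}} (hT : Admissible T) (At : PartOrd.{u}) :
    (Lang hT At).IsFreeOn (atom hT At) :=
  (exists_isFreeOn hT.finitary At).choose_spec.choose_spec

/-! ## Relation lifting and restrictions

These facts show that the semantics below is well defined. -/

/-- Relation lifting commutes with restrictions. -/
theorem lift_restrict {T : PartOrd.{u} ⥤ PartOrd.{u}} (hT : PreservesExactSquares T)
    {X Y A : PartOrd.{u}} (R : MonRel X Y) (f : A ⟶ X) (β : T.obj Y) (α : T.obj A) :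
    ((R.restrict f).lift T).rel β α ↔ (R.lift T).rel β (T.map f α) := by
  constructor
  · rintro ⟨w, h1, h2⟩
    let k : (R.restrict f).graph ⟶ R.graph :=
      PartOrd.ofHom ⟨fun p => ⟨(p.1.1, f p.1.2), p.2⟩, fun _ _ h => ⟨h.1, f.hom.monotone h.2⟩⟩
    have e0 : k ≫ R.p0 = (R.restrict f).p0 := rfl
    have e1 : k ≫ R.p1 = (R.restrict f).p1 ≫ f := rfl
    refine ⟨T.map k w, ?_, ?_⟩
    · rw [← PartOrd.comp_apply, ← T.map_comp, e0]
      exact h1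
    · rw [← PartOrd.comp_apply, ← T.map_comp, e1, T.map_comp, PartOrd.comp_apply]
      exact (T.map f).hom.monotone h2
  · rintro ⟨w, h1, h2⟩
    let P : PartOrd.{u} := PartOrd.of {p : R.graph × A // R.p1 p.1 ≤ f p.2}
    let q0 : P ⟶ R.graph := PartOrd.ofHom ⟨fun p => p.1.1, fun _ _ h => h.1⟩
    let q1 : P ⟶ A := PartOrd.ofHom ⟨fun p => p.1.2, fun _ _ h => h.2⟩
    have hP : IsExactSquare q0 q1 R.p1 f :=
      ⟨fun w => w.2, fun a b h => ⟨⟨(a, b), h⟩, le_rfl, le_rfl⟩⟩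
    obtain ⟨v, hv0, hv1⟩ := (hT _ _ _ _ hP).exact_of_le w α h2
    let k : P ⟶ (R.restrict f).graph :=
      PartOrd.ofHom ⟨fun p => ⟨(p.1.1.1.1, p.1.2), R.mono le_rfl p.2 p.1.1.2⟩,
        fun _ _ h => ⟨h.1.1, h.2⟩⟩
    have e0 : k ≫ (R.restrict f).p0 = q0 ≫ R.p0 := rfl
    have e1 : k ≫ (R.restrict f).p1 = q1 := rfl
    refine ⟨T.map k v, ?_, ?_⟩
    · rw [← PartOrd.comp_apply, ← T.map_comp, e0, T.map_comp, PartOrd.comp_apply]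
      exact h1.trans ((T.map R.p0).hom.monotone hv0)
    · rw [← PartOrd.comp_apply, ← T.map_comp, e1]
      exact hv1

theorem IsExactSquare.dual {P A B C : PartOrd.{u}} {p₀ : P ⟶ A} {p₁ : P ⟶ B} {f : A ⟶ C}
    {g : B ⟶ C} (h : IsExactSquare p₀ p₁ f g) :
    IsExactSquare (PartOrd.dual.map p₁) (PartOrd.dual.map p₀) (PartOrd.dual.map g)
      (PartOrd.dual.map f) :=
  ⟨fun w => h.lax w, fun b a hab => by
    obtain ⟨w, h1, h2⟩ := h.exact_of_le a b hab
    exact ⟨w, h2, h1⟩⟩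

theorem preservesExactSquares_dualFunctor {T : PartOrd.{u} ⥤ PartOrd.{u}}
    (hT : PreservesExactSquares T) : PreservesExactSquares (dualFunctor T) :=
  fun _ _ _ _ _ _ _ _ h => (hT _ _ _ _ h.dual).dual

/-! ## Semantics -/

/-- The identity `X → (Xᵒᵖ)ᵒᵖ`. -/
def dualDual (X : PartOrd.{u}) : X ⟶ PartOrd.dual.obj (PartOrd.dual.obj X) :=
  PartOrd.ofHom ⟨fun x => OrderDual.toDual (OrderDual.toDual x), fun _ _ h => h⟩

/-- `S : L ⇸ Xᵒᵖ`, where `L` is the language, is the semantics `⊩` of formulas in the coalgebra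
`c` under the valuation `v : At ⇸ Xᵒᵖ`, that is, it satisfies the inductive clauses. -/
structure IsSemantics {T : PartOrd.{u} ⥤ PartOrd.{u}} (hT : Admissible T) {At X : PartOrd.{u}}
    (c : X ⟶ T.obj X) (v : MonRel At (PartOrd.dual.obj X))
    (S : MonRel (Lang hT At).carrier (PartOrd.dual.obj X)) : Prop where
  /-- `x ⊩ p` iff `x ⊩₀ p`. -/
  atom : ∀ (x : X) (p : At), S.rel (OrderDual.toDual x) (atom hT At p) ↔
    v.rel (OrderDual.toDual x) p
  /-- `x ⊩ ⋀ φ` iff `x ⊩ a` for all `a ∈ φ`. -/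
  conj : ∀ (x : X) (φ : Uω.obj (Lang hT At).carrier),
    S.rel (OrderDual.toDual x) ((Lang hT At).conj φ) ↔ ∀ a ∈ φ.1, S.rel (OrderDual.toDual x) a
  /-- `x ⊩ ⋁ ψ` iff `x ⊩ a` for some `a ∈ ψ`. -/
  disj : ∀ (x : X) (ψ : Lω.obj (Lang hT At).carrier),
    S.rel (OrderDual.toDual x) ((Lang hT At).disj ψ) ↔ ∃ a ∈ ψ.1, S.rel (OrderDual.toDual x) a
  /-- `x ⊩ ∇ α` iff `c(x)` is related to `α` by the lifting of `⊩` along `T^∂`. -/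
  nabla : ∀ (x : X) (α : (dualFunctor T).obj (Lang hT At).carrier),
    S.rel (OrderDual.toDual x) ((Lang hT At).nabla α) ↔
      (S.lift (dualFunctor T)).rel (OrderDual.toDual (T.map (dualDual X) (c x))) α
  /-- `x ⊮ Δ α` iff `c(x)` is related to `α` by the lifting of `⊮` along `T`. -/
  delta : ∀ (x : X) (α : (dualFunctor T).obj (Lang hT At).carrier),
    ¬ S.rel (OrderDual.toDual x) ((Lang hT At).delta α) ↔
      (S.neg.lift T).rel (T.map (dualDual X) (c x)) (OrderDual.ofDual α)

/-- The poset of monotone predicates on `X` (uppersets, ordered by inclusion). -/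
abbrev Predicates (X : PartOrd.{u}) : PartOrd.{u} := PartOrd.of (X →o Prop)

/-- Evaluation of predicates, as a monotone relation. -/
def evalRel (X : PartOrd.{u}) : MonRel (Predicates X) (PartOrd.dual.obj X) where
  rel x p := p (OrderDual.ofDual x)
  mono := fun {_ _ x _} hy hx h => hx _ (x.monotone hy h)

/-- The algebra of monotone predicates on a coalgebra. -/
def predAlg {T : PartOrd.{u} ⥤ PartOrd.{u}} {X : PartOrd.{u}} (c : X ⟶ T.obj X) : LangAlg T where
  carrier := Predicates X
  conj := PartOrd.ofHom
    { toFun := fun φ => ⟨fun x => ∀ p ∈ φ.1, p x, fun _ _ h h' p hp => p.monotone h (h' p hp)⟩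
      monotone' := fun _ _ h _ h' p hp => h' p (h hp) }
  disj := PartOrd.ofHom
    { toFun := fun ψ => ⟨fun x => ∃ p ∈ ψ.1, p x, fun _ _ h ⟨p, hp, hx⟩ =>
        ⟨p, hp, p.monotone h hx⟩⟩
      monotone' := fun _ _ h _ ⟨p, hp, hx⟩ => ⟨p, h hp, hx⟩ }
  nabla := PartOrd.ofHom
    { toFun := fun α => ⟨fun x => ((evalRel X).lift (dualFunctor T)).rel
          (OrderDual.toDual (T.map (dualDual X) (c x))) α, fun _ _ h =>
        ((evalRel X).lift (dualFunctor T)).mono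
          ((c ≫ T.map (dualDual X)).hom.monotone h) le_rfl⟩
      monotone' := fun _ _ h _ => ((evalRel X).lift (dualFunctor T)).mono le_rfl h }
  delta := PartOrd.ofHom
    { toFun := fun α => ⟨fun x => ¬ ((evalRel X).neg.lift T).rel
          (T.map (dualDual X) (c x)) (OrderDual.ofDual α), fun _ _ h =>
        mt (((evalRel X).neg.lift T).mono ((c ≫ T.map (dualDual X)).hom.monotone h) le_rfl)⟩
      monotone' := fun _ _ h _ => mt (((evalRel X).neg.lift T).mono le_rfl h) }

/-- Every valuation extends uniquely to a semantics of all formulas. -/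
theorem existsUnique_isSemantics {T : PartOrd.{u} ⥤ PartOrd.{u}} (hT : Admissible T)
    {At X : PartOrd.{u}} (c : X ⟶ T.obj X) (v : MonRel At (PartOrd.dual.obj X)) :
    ∃! S : MonRel (Lang hT At).carrier (PartOrd.dual.obj X), IsSemantics hT c v S := by
  have hTd := preservesExactSquares_dualFunctor hT.exactSquares
  let g : At ⟶ Predicates X := PartOrd.ofHom
    { toFun := fun p => ⟨fun x => v.rel (OrderDual.toDual x) p, fun _ _ h => v.mono h le_rfl⟩
      monotone' := fun _ _ h _ => v.mono le_rfl h }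
  let app : Predicates X → X → Prop := fun p x => (p : X →o Prop) x
  have key : ∀ k : (Lang hT At).carrier ⟶ Predicates X,
      ((Lang hT At).IsHom (predAlg c) k ∧ atom hT At ≫ k = g) ↔
        IsSemantics hT c v ((evalRel X).restrict k) := by
    intro k
    have hnab : ∀ (x : X) (α : (dualFunctor T).obj (Lang hT At).carrier),
        app ((predAlg c).nabla ((dualFunctor T).map k α)) x ↔
          (((evalRel X).restrict k).lift (dualFunctor T)).rel
            (OrderDual.toDual (T.map (dualDual X) (c x))) α :=
      fun x α => (lift_restrict hTd (evalRel X) k _ α).symm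
    have hdel : ∀ (x : X) (α : (dualFunctor T).obj (Lang hT At).carrier),
        ¬ app ((predAlg c).delta ((dualFunctor T).map k α)) x ↔
          (((evalRel X).restrict k).neg.lift T).rel
            (T.map (dualDual X) (c x)) (OrderDual.ofDual α) :=
      fun x α => not_not.trans (lift_restrict hT.exactSquares (evalRel X).neg
        (PartOrd.dual.map k) _ (OrderDual.ofDual α)).symm
    have hcon : ∀ (x : X) (φ : Uω.obj (Lang hT At).carrier),
        app ((predAlg c).conj (Uω.map k φ)) x ↔ ∀ a ∈ φ.1, k a x := by
      intro x φ
      constructor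
      · exact fun h a ha => h _ (subset_upperClosure ⟨a, ha, rfl⟩)
      · rintro h p ⟨_, ⟨a, ha, rfl⟩, hap⟩
        exact hap x (h a ha)
    have hdis : ∀ (x : X) (φ : Lω.obj (Lang hT At).carrier),
        app ((predAlg c).disj (Lω.map k φ)) x ↔ ∃ a ∈ φ.1, k a x := by
      intro x φ
      constructor
      · rintro ⟨p, ⟨_, ⟨a, ha, rfl⟩, hap⟩, hp⟩
        exact ⟨a, ha, hap x hp⟩
      · rintro ⟨a, ha, h⟩
        exact ⟨_, subset_lowerClosure ⟨a, ha, rfl⟩, h⟩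
    constructor
    · rintro ⟨h, hg⟩
      have e1 := fun z (x : X) => iff_of_eq
        (congrArg (fun q => app q x) (ConcreteCategory.congr_hom h.conj z))
      have e2 := fun z (x : X) => iff_of_eq
        (congrArg (fun q => app q x) (ConcreteCategory.congr_hom h.disj z))
      have e3 := fun z (x : X) => iff_of_eq
        (congrArg (fun q => app q x) (ConcreteCategory.congr_hom h.nabla z))
      have e4 := fun z (x : X) => iff_of_eq
        (congrArg (fun q => app q x) (ConcreteCategory.congr_hom h.delta z))
      have e5 := fun z (x : X) => iff_of_eq
        (congrArg (fun q => app q x) (ConcreteCategory.congr_hom hg z))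
      exact ⟨fun x p => e5 p x, fun x φ => (e1 φ x).symm.trans (hcon x φ),
        fun x φ => (e2 φ x).symm.trans (hdis x φ), fun x α => (e3 α x).symm.trans (hnab x α),
        fun x α => (not_congr (e4 α x)).symm.trans (hdel x α)⟩
    · intro h
      refine ⟨⟨?_, ?_, ?_, ?_⟩, ?_⟩ <;> refine PartOrd.ext fun z => OrderHom.ext _ _ (funext
        fun x => propext ?_)
      · exact (hcon x z).trans (h.conj x z).symm
      · exact (hdis x z).trans (h.disj x z).symm
      · exact (hnab x z).trans (h.nabla x z).symm
      · exact not_iff_not.1 ((hdel x z).trans (h.delta x z).symm)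
      · exact h.atom x z
  obtain ⟨h, hh, huniq⟩ := isFreeOn_atom hT At (predAlg c) g
  refine ⟨(evalRel X).restrict h, (key h).1 hh, fun S hS => ?_⟩
  let k : (Lang hT At).carrier ⟶ Predicates X := PartOrd.ofHom
    { toFun := fun a => ⟨fun x => S.rel (OrderDual.toDual x) a, fun _ _ h => S.mono h le_rfl⟩
      monotone' := fun _ _ h _ => S.mono le_rfl h }
  have hk : (evalRel X).restrict k = S := rfl
  rw [← hk, huniq k ((key k).2 (hk ▸ hS))]

/-- The semantics `⊩` of formulas in the coalgebra `c` under the valuation `v`. -/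
def sat {T : PartOrd.{u} ⥤ PartOrd.{u}} (hT : Admissible T) {At X : PartOrd.{u}}
    (c : X ⟶ T.obj X) (v : MonRel At (PartOrd.dual.obj X)) :
    MonRel (Lang hT At).carrier (PartOrd.dual.obj X) :=
  (existsUnique_isSemantics hT c v).choose

theorem isSemantics_sat {T : PartOrd.{u} ⥤ PartOrd.{u}} (hT : Admissible T) {At X : PartOrd.{u}}
    (c : X ⟶ T.obj X) (v : MonRel At (PartOrd.dual.obj X)) :
    IsSemantics hT c v (sat hT c v) :=
  (existsUnique_isSemantics hT c v).choose_spec.1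

/-- The semantic preorder `a ⊑ b`: in all coalgebras, under all valuations, `x ⊩ a` implies
`x ⊩ b`. -/
def SemLE {T : PartOrd.{u} ⥤ PartOrd.{u}} (hT : Admissible T) {At : PartOrd.{u}}
    (a b : (Lang hT At).carrier) : Prop :=
  ∀ (X : PartOrd.{u}) (c : X ⟶ T.obj X) (v : MonRel At (PartOrd.dual.obj X)) (x : X),
    (sat hT c v).rel (OrderDual.toDual x) a → (sat hT c v).rel (OrderDual.toDual x) b

/-- Semantic equivalence `a ≡ b`. -/
def SemEquiv {T : PartOrd.{u} ⥤ PartOrd.{u}} (hT : Admissible T) {At : PartOrd.{u}}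
    (a b : (Lang hT At).carrier) : Prop :=
  SemLE hT a b ∧ SemLE hT b a

/-! ## The relation `¬T̄(∌)` and the collections `L_β` -/

/-- The relation `¬T̄(∌) : T^∂ X ⇸ T^∂ U_ω X`, where `∌ : Xᵒᵖ ⇸ (U_ω X)ᵒᵖ` is the negation of the
membership relation. -/
def negLiftNotMem (T : PartOrd.{u} ⥤ PartOrd.{u}) (X : PartOrd.{u}) :
    MonRel ((dualFunctor T).obj X) ((dualFunctor T).obj (Uω.obj X)) :=
  ((sqni X).neg.lift T).neg

/-- The inclusion of `T^∂ U_ω base(β)` in `T^∂ U_ω X`, for `β ∈ T^∂ X`. -/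
def baseIncl (T : PartOrd.{u} ⥤ PartOrd.{u}) {X : PartOrd.{u}} (β : (dualFunctor T).obj X) :
    (dualFunctor T).obj (Uω.obj (PartOrd.of (base (dualFunctor T) β))) ⟶
      (dualFunctor T).obj (Uω.obj X) :=
  (dualFunctor T).map (Uω.map (incl (base (dualFunctor T) β)))

/-- The collection `L_β` of all `Φ ∈ T^∂ U_ω base(β)` with `Φ ¬T̄(∌) β`. -/
def LColl (T : PartOrd.{u} ⥤ PartOrd.{u}) {X : PartOrd.{u}} (β : (dualFunctor T).obj X) :
    Set ((dualFunctor T).obj (Uω.obj (PartOrd.of (base (dualFunctor T) β)))) :=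
  {Φ | (negLiftNotMem T X).rel (baseIncl T β Φ) β}

/-- The map `Φ ↦ ∇(T^∂⋀)Φ` from `T^∂ U_ω L` to the language `L`. -/
def nablaConj {T : PartOrd.{u} ⥤ PartOrd.{u}} (hT : Admissible T) (At : PartOrd.{u}) :
    (dualFunctor T).obj (Uω.obj (Lang hT At).carrier) ⟶ (Lang hT At).carrier :=
  (dualFunctor T).map (Lang hT At).conj ≫ (Lang hT At).nabla

/-- The disjunction `⋁ s` of a finite set of formulas. -/
def finDisj {T : PartOrd.{u} ⥤ PartOrd.{u}} (hT : Admissible T) {At : PartOrd.{u}}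
    (s : Set (Lang hT At).carrier) (hs : s.Finite) : (Lang hT At).carrier :=
  (Lang hT At).disj (finLower s hs)

end MossLogic

end

open MossLogic

/-! Write `all` for the relation "`y` satisfies every element of `φ`" between points and finitely
generated uppersets of formulas. The clause for `⋀` says that `all` is `⊩` restricted along `⋀`.
Since lifting commutes with restriction, `x ⊩ ∇(T^∂⋀)Φ` means that `c(x)` is related to `Φ` by the
`T^∂`-lifting of `all`. By its own clause, `x ⊩ Δβ` means that `c(x)` is not related to `β` by the
`T`-lifting of `⊮`. The proposition thus becomes a statement about liftings of a single monotone
relation `S`.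

From `Φ` to `Δβ`: if `y` satisfies all of `φ` but not `a`, then `a ∉ φ`. So the converse of `all`
followed by `⊮` is contained in `∌`. Liftings compose laxly, by preservation of exact squares, so
`c(x) T̄(⊮) β` would force `Φ T̄(∌) β`, contrary to the choice of `Φ` (`not_lift_neg_of_lift_all`).

From `Δβ` to `Φ`: let `B` be the base of `β`. It is finite, so sending `y` to the set of formulas in
`B` true at `y` is a monotone map `th : Xᵒᵖ → U_ω B`. Take `Φ = T^∂ th (c x)`. Each `y` satisfies
all of `th y`, so `c(x)` is related to `Φ` by the lifted `all`. If `b ∈ B` is not in `th y` then `y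
⊮ b`, so `Φ T̄(∌) β` would give `c(x) T̄(⊮) β` (`exists_lift_all_of_not_lift_neg`). This `Φ` lies in
`L_β` by construction, which gives part (2) as well as part (1).

The base is finite and supports `β` (`finite_base`) because every poset is the directed colimit of
its finite subposets and supports are closed under binary intersection. -/

noncomputable section

namespace MossLogic

/-! ### Calculus of relation liftings -/

namespace MonRel

variable {X Y Z A : PartOrd.{u}}

/-- The converse of a monotone relation, as a relation between the dual posets. -/
def conv (R : MonRel X Y) : MonRel (PartOrd.dual.obj Y) (PartOrd.dual.obj X) where
  rel x y := R.rel (OrderDual.ofDual y) (OrderDual.ofDual x)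
  mono := fun hx hy h => R.mono hy hx h

/-- A span of monotone maps into a relation induces a span into its lifting. -/
theorem lift_rel_map (T : PartOrd.{u} ⥤ PartOrd.{u}) (R : MonRel X Y) (f : A ⟶ Y) (g : A ⟶ X)
    (h : ∀ a, R.rel (f a) (g a)) (w : T.obj A) : (R.lift T).rel (T.map f w) (T.map g w) := by
  let k : A ⟶ R.graph := PartOrd.ofHom
    ⟨fun a => ⟨(f a, g a), h a⟩, fun _ _ hab => ⟨f.hom.monotone hab, g.hom.monotone hab⟩⟩
  have e0 : k ≫ R.p0 = f := rfl
  have e1 : k ≫ R.p1 = g := rfl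
  refine ⟨T.map k w, ?_, ?_⟩
  · rw [← PartOrd.comp_apply, ← T.map_comp, e0]
  · rw [← PartOrd.comp_apply, ← T.map_comp, e1]

/-- The two projections of the graph of `R` form a span lying in `S`. -/
theorem lift_mono (T : PartOrd.{u} ⥤ PartOrd.{u}) {R S : MonRel X Y}
    (h : ∀ y x, R.rel y x → S.rel y x) {β : T.obj Y} {α : T.obj X}
    (hR : (R.lift T).rel β α) : (S.lift T).rel β α := by
  obtain ⟨w, h0, h1⟩ := hR
  exact (S.lift T).mono h0 h1 (lift_rel_map T S R.p0 R.p1 (fun p => h _ _ p.2) w)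

/-- The composite of liftings is contained in the lifting of the composite. -/
theorem lift_comp {T : PartOrd.{u} ⥤ PartOrd.{u}} (hT : PreservesExactSquares T)
    (S : MonRel Y Z) (R : MonRel X Y) {γ : T.obj Z} {β : T.obj Y} {α : T.obj X}
    (hS : (S.lift T).rel γ β) (hR : (R.lift T).rel β α) : ((S.comp R).lift T).rel γ α := by
  obtain ⟨w, hw0, hw1⟩ := hS
  obtain ⟨w', hw0', hw1'⟩ := hR
  -- The comma object of the two projections to `Y` is an exact square. Its image under `T` is again
  -- exact, so the witnesses `w` and `w'`, which match only up to `≤` over `T Y`, are bounded by the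
  -- two projections of one element `v` of `T P`.
  let P : PartOrd.{u} := PartOrd.of {p : S.graph × R.graph // S.p1 p.1 ≤ R.p0 p.2}
  let q0 : P ⟶ S.graph := PartOrd.ofHom ⟨fun p => p.1.1, fun _ _ h => h.1⟩
  let q1 : P ⟶ R.graph := PartOrd.ofHom ⟨fun p => p.1.2, fun _ _ h => h.2⟩
  have hP : IsExactSquare q0 q1 S.p1 R.p0 :=
    ⟨fun w => w.2, fun a b h => ⟨⟨(a, b), h⟩, le_rfl, le_rfl⟩⟩
  obtain ⟨v, hv0, hv1⟩ := (hT _ _ _ _ hP).exact_of_le w w' (hw1.trans hw0')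
  have key := lift_rel_map T (S.comp R) (q0 ≫ S.p0) (q1 ≫ R.p1)
    -- The intermediate point is taken from the `S`-side; the inequality stored in `P` is absorbed
    -- by `R` being antitone in `Y`.
    (fun p => ⟨S.p1 p.1.1, p.1.1.2, R.mono p.2 le_rfl p.1.2.2⟩) v
  rw [T.map_comp, T.map_comp, PartOrd.comp_apply, PartOrd.comp_apply] at key
  exact ((S.comp R).lift T).mono (hw0.trans ((T.map S.p0).hom.monotone hv0))
    (((T.map R.p1).hom.monotone hv1).trans hw1') key

/-- Liftings along `T^∂` are converses of liftings along `T`. -/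
theorem lift_conv_of_lift_dualFunctor (T : PartOrd.{u} ⥤ PartOrd.{u}) (R : MonRel X Y)
    {β : (dualFunctor T).obj Y} {α : (dualFunctor T).obj X}
    (h : (R.lift (dualFunctor T)).rel β α) :
    (R.conv.lift T).rel (OrderDual.ofDual α) (OrderDual.ofDual β) := by
  obtain ⟨w, h0, h1⟩ := h
  exact (R.conv.lift T).mono h1 h0
    (lift_rel_map T R.conv (PartOrd.dual.map R.p1) (PartOrd.dual.map R.p0) (fun p => p.2) w)

/-- Liftings reflect restrictions of relations on both sides. -/
theorem lift_of_lift_map {T : PartOrd.{u} ⥤ PartOrd.{u}} (hT : PreservesExactSquares T)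
    {B : PartOrd.{u}} (R : MonRel X Y) (R' : MonRel B A) (f : A ⟶ Y) (g : B ⟶ X)
    (h : ∀ a b, R.rel (f a) (g b) → R'.rel a b) {γ : T.obj A} {β : T.obj B}
    (hR : (R.lift T).rel (T.map f γ) (T.map g β)) : (R'.lift T).rel γ β := by
  -- Restriction on the right is handled by `lift_restrict`. On the left, `f` is replaced by the
  -- monotone relation it represents: the lifting of `F` relates `γ` to `T f γ`, and lax composition
  -- with `R(-, g-)` does the rest.
  let F : MonRel Y A := ⟨fun a y => f a ≤ y, fun ha hy h => (f.hom.monotone ha).trans (h.trans hy)⟩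
  have hF : (F.lift T).rel γ (T.map f γ) := by
    simpa using lift_rel_map T F (𝟙 A) f (fun _ => le_refl (f _)) γ
  refine lift_mono T ?_ (lift_comp hT F (R.restrict g) hF ((lift_restrict hT R g _ _).2 hR))
  rintro a b ⟨y, hy, hyb⟩
  exact h a b (R.mono hy le_rfl hyb)

/-! ### The two implications for an arbitrary monotone relation -/

/-- The relation of satisfying all elements of a finitely generated upperset. -/
def all (S : MonRel X Y) : MonRel (Uω.obj X) Y where
  rel y φ := ∀ a ∈ φ.1, S.rel y a
  mono := fun hy hφ h a ha => S.mono hy le_rfl (h a (hφ ha))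

/-- A point that satisfies every element of `φ` and fails `a` witnesses `a ∉ φ`. Lifting this
containment through lax composition contradicts `hβ`. -/
theorem not_lift_neg_of_lift_all {T : PartOrd.{u} ⥤ PartOrd.{u}} (hT : PreservesExactSquares T)
    (S : MonRel X Y) {γ : (dualFunctor T).obj Y} {Φ : (dualFunctor T).obj (Uω.obj X)}
    {β : (dualFunctor T).obj X} (hΦ : (S.all.lift (dualFunctor T)).rel γ Φ)
    (hβ : (negLiftNotMem T X).rel Φ β) :
    ¬ (S.neg.lift T).rel (OrderDual.ofDual γ) (OrderDual.ofDual β) := by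
  intro h
  refine hβ (lift_mono T ?_ (lift_comp hT _ _ (lift_conv_of_lift_dualFunctor T _ hΦ) h))
  rintro φ a ⟨y, hy, hya⟩ ha
  exact hya (hy _ ha)

/-- The elements of a finite subposet that satisfy a given element. -/
def finTheory (S : MonRel X Y) {B : Set X} (hB : B.Finite) :
    Y ⟶ Uω.obj (PartOrd.of B) :=
  PartOrd.ofHom
    { toFun := fun y => ⟨⟨{b | S.rel y b.1}, fun _ _ hab h => S.mono le_rfl hab h⟩,
        -- The upperset generates itself; finiteness of `B` makes this a finite generating set.
        {b | S.rel y b.1}, (have := hB.to_subtype; Set.toFinite _), by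
          refine SetLike.coe_injective ?_
          rw [coe_upperClosure]
          ext b
          simp only [Set.mem_iUnion, Set.mem_Ici, exists_prop]
          exact ⟨fun h => ⟨b, h, le_rfl⟩, fun ⟨a, ha, hab⟩ => S.mono le_rfl hab ha⟩⟩
      monotone' := fun _ _ h _ hb => S.mono h le_rfl hb }

theorem mem_map_finTheory (S : MonRel X Y) {B : Set X} (hB : B.Finite) (y : Y) (a : X) :
    a ∈ ((S.finTheory hB ≫ Uω.map (incl B)) y).1 ↔ ∃ b ∈ B, S.rel y b ∧ b ≤ a := by
  constructor
  · rintro ⟨_, ⟨b, hb, rfl⟩, hba⟩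
    exact ⟨b.1, b.2, hb, hba⟩
  · rintro ⟨b, hb, hyb, hba⟩
    exact ⟨_, ⟨⟨b, hb⟩, hyb, rfl⟩, hba⟩

/-- The witness is the image of `γ` under the lifted theory map. It records exactly which elements
of the finite support `B` hold, which is enough because `β` comes from `T^∂ B`. -/
theorem exists_lift_all_of_not_lift_neg {T : PartOrd.{u} ⥤ PartOrd.{u}}
    (hT : PreservesExactSquares T) (S : MonRel X Y) {γ : (dualFunctor T).obj Y}
    {β : (dualFunctor T).obj X} {B : Set X} (hB : B.Finite)
    (hβ : β ∈ Set.range ((dualFunctor T).map (incl B)))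
    (h : ¬ (S.neg.lift T).rel (OrderDual.ofDual γ) (OrderDual.ofDual β)) :
    ∃ Φ : (dualFunctor T).obj (Uω.obj (PartOrd.of B)),
      (negLiftNotMem T X).rel ((dualFunctor T).map (Uω.map (incl B)) Φ) β ∧
      (S.all.lift (dualFunctor T)).rel γ ((dualFunctor T).map (Uω.map (incl B)) Φ) := by
  obtain ⟨β, rfl⟩ := hβ
  refine ⟨(dualFunctor T).map (S.finTheory hB) γ, ?_, ?_⟩
  · rw [← PartOrd.comp_apply, ← Functor.map_comp]
    intro hn
    -- Both arguments of the lifted `∌` are images, under the theory map and under the inclusion of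
    -- `B`, so it can be pulled back to a relation between points and elements of `B`, where it is
    -- contained in the negation of `S`.
    refine h ((lift_restrict hT S.neg (PartOrd.dual.map (incl B)) _ _).1 ?_)
    refine lift_of_lift_map hT _ _ (PartOrd.dual.map (S.finTheory hB ≫ Uω.map (incl B)))
      (PartOrd.dual.map (incl B)) ?_ hn
    intro y b hyb hy
    exact hyb ((mem_map_finTheory S hB _ _).2 ⟨_, b.2, hy, le_rfl⟩)
  · rw [← PartOrd.comp_apply, ← Functor.map_comp]
    -- The span formed by the identity and the theory map lies in `S.all`.
    have := lift_rel_map (dualFunctor T) S.all (𝟙 Y) (S.finTheory hB ≫ Uω.map (incl B)) (by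
      intro y a ha
      obtain ⟨b, -, hb, hba⟩ := (mem_map_finTheory S hB _ _).1 ha
      exact S.mono le_rfl hba hb) γ
    rwa [CategoryTheory.Functor.map_id, PartOrd.id_apply] at this

end MonRel

/-! ## Finite bases -/

/-- The legs of a colimit cocone of posets are jointly surjective. -/
theorem exists_of_isColimit {J : Type u} [Category.{u} J] {D : J ⥤ PartOrd.{u}} {t : Cocone D}
    (ht : IsColimit t) (y : t.pt) : ∃ j, ∃ a : D.obj j, t.ι.app j a = y := by
  -- The joint image, with the induced order, is again a cocone. The map into it induced by the
  -- colimit, followed by the inclusion, is the identity, so every point lies in the image.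
  let I : Set t.pt := {y | ∃ j, ∃ a : D.obj j, t.ι.app j a = y}
  let s : Cocone D :=
    { pt := PartOrd.of I
      ι :=
        { app := fun j => PartOrd.ofHom
            ⟨fun a => ⟨t.ι.app j a, j, a, rfl⟩, fun _ _ h => (t.ι.app j).hom.monotone h⟩
          naturality := fun i j f => PartOrd.ext fun a => Subtype.ext
            (ConcreteCategory.congr_hom (t.w f) a) } }
  have h : ht.desc s ≫ incl I = 𝟙 t.pt := ht.hom_ext fun j => by
    rw [← Category.assoc, ht.fac, Category.comp_id]
    rfl
  have hy := ConcreteCategory.congr_hom h y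
  rw [PartOrd.comp_apply, PartOrd.id_apply] at hy
  rw [← hy]
  exact (ht.desc s y).2

/-- The diagram of finite subposets of a poset. -/
def finiteSubposets (X : PartOrd.{u}) : Finset X ⥤ PartOrd.{u} where
  obj s := PartOrd.of (s : Set X)
  map f := PartOrd.ofHom ⟨fun x => ⟨x.1, leOfHom f x.2⟩, fun _ _ h => h⟩

/-- The cocone of the inclusions of the finite subposets of a poset. -/
def finiteSubposetsCocone (X : PartOrd.{u}) : Cocone (finiteSubposets X) where
  pt := X
  ι := { app := fun s => incl (s : Set X) }

/-- Every poset is the colimit of its finite subposets. -/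
def isColimitFiniteSubposetsCocone (X : PartOrd.{u}) :
    IsColimit (finiteSubposetsCocone X) := by
  -- The value of a cocone at `x` does not depend on the finite subset containing `x`. Singletons
  -- therefore determine the induced map, and the pair `{x, y}` shows its monotonicity.
  have hw : ∀ (s : Cocone (finiteSubposets X)) {a b : Finset X} (h : a ⊆ b) (x : X) (hx : x ∈ a),
      s.ι.app a ⟨x, hx⟩ = s.ι.app b ⟨x, h hx⟩ := fun s a b h x hx =>
    (ConcreteCategory.congr_hom (s.w (homOfLE h)) ⟨x, hx⟩).symm
  classical exact
  { desc := fun s => PartOrd.ofHom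
      { toFun := fun x => s.ι.app {x} ⟨x, Finset.mem_singleton_self x⟩
        monotone' := fun x y hxy => by
          have hx := hw s (show ({x} : Finset X) ⊆ {x, y} by simp) x (by simp)
          have hy := hw s (show ({y} : Finset X) ⊆ {x, y} by simp) y (by simp)
          exact hx.le.trans (((s.ι.app {x, y}).hom.monotone hxy).trans hy.ge) }
    fac := fun s a => PartOrd.ext fun x =>
      hw s (Finset.singleton_subset_iff.2 x.2) x.1 (Finset.mem_singleton_self _)
    uniq := fun s f hf => PartOrd.ext fun x =>
      ConcreteCategory.congr_hom (hf {x}) ⟨x, Finset.mem_singleton_self x⟩ }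

/-- `F` preserves the directed colimit of the finite subposets of `X`, and the legs of the image
cocone are jointly surjective. -/
theorem exists_finite_mem_range_map_incl {F : PartOrd.{u} ⥤ PartOrd.{u}}
    (hF : PreservesFilteredColimitsOfSize.{u, u} F) {X : PartOrd.{u}} (α : F.obj X) :
    ∃ S : Set X, S.Finite ∧ α ∈ Set.range (F.map (incl S)) := by
  classical
  have : PreservesColimitsOfShape (Finset X) F :=
    PreservesFilteredColimitsOfSize.preserves_filtered_colimits (Finset X)
  obtain ⟨s, a, h⟩ := exists_of_isColimit
    (isColimitOfPreserves F (isColimitFiniteSubposetsCocone X)) α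
  exact ⟨s, s.finite_toSet, a, h⟩

/-- Elements are maps from the one-element poset, so a matching pair of elements is a cone. -/
theorem exists_of_isPullback {P A B C : PartOrd.{u}} {p : P ⟶ A} {q : P ⟶ B} {f : A ⟶ C}
    {g : B ⟶ C} (h : IsPullback p q f g) {a : A} {b : B} (hab : f a = g b) :
    ∃ w, p w = a ∧ q w = b := by
  let a' : PartOrd.of PUnit.{u + 1} ⟶ A := PartOrd.ofHom ⟨fun _ => a, fun _ _ _ => le_rfl⟩
  let b' : PartOrd.of PUnit.{u + 1} ⟶ B := PartOrd.ofHom ⟨fun _ => b, fun _ _ _ => le_rfl⟩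
  have e : a' ≫ f = b' ≫ g := PartOrd.ext fun _ => hab
  exact ⟨h.lift a' b' e PUnit.unit, ConcreteCategory.congr_hom (h.lift_fst a' b' e) PUnit.unit,
    ConcreteCategory.congr_hom (h.lift_snd a' b' e) PUnit.unit⟩

/-- The inclusion of a subposet in a larger one. -/
def inclOfSubset {X : PartOrd.{u}} {S S' : Set X} (h : S ⊆ S') : PartOrd.of S ⟶ PartOrd.of S' :=
  PartOrd.ofHom ⟨Set.inclusion h, fun _ _ h => h⟩

theorem isPullback_incl_inter {X : PartOrd.{u}} (S S' : Set X) :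
    IsPullback (inclOfSubset (Set.inter_subset_left : S ∩ S' ⊆ S))
      (inclOfSubset Set.inter_subset_right) (incl S) (incl S') := by
  have w : inclOfSubset (Set.inter_subset_left : S ∩ S' ⊆ S) ≫ incl S =
    inclOfSubset (Set.inter_subset_right : S ∩ S' ⊆ S') ≫ incl S' := rfl
  have hmem (s : PullbackCone (incl S) (incl S')) (z : s.pt) : (s.fst z).1 ∈ S ∩ S' := by
    have : (s.fst z).1 = (s.snd z).1 := ConcreteCategory.congr_hom s.condition z
    exact ⟨(s.fst z).2, this ▸ (s.snd z).2⟩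
  exact ⟨⟨w⟩, ⟨PullbackCone.IsLimit.mk w
    (fun s => PartOrd.ofHom
      ⟨fun z => ⟨(s.fst z).1, hmem s z⟩, fun _ _ h => s.fst.hom.monotone h⟩)
    (fun s => rfl)
    (fun s => PartOrd.ext fun z => Subtype.ext (ConcreteCategory.congr_hom s.condition z))
    (fun s m h _ => PartOrd.ext fun z => Subtype.ext <| by
      have := congrArg Subtype.val (ConcreteCategory.congr_hom h z)
      exact this)⟩⟩

/-- Supports of `α` are closed under binary intersection, since `F` preserves the pullback of the
two inclusions. -/
theorem mem_range_map_incl_inter {F : PartOrd.{u} ⥤ PartOrd.{u}} (hF : PreservesIntersections F)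
    {X : PartOrd.{u}} {α : F.obj X} {S S' : Set X} (h : α ∈ Set.range (F.map (incl S)))
    (h' : α ∈ Set.range (F.map (incl S'))) : α ∈ Set.range (F.map (incl (S ∩ S'))) := by
  obtain ⟨a, rfl⟩ := h
  obtain ⟨b, hb⟩ := h'
  obtain ⟨w, hw, -⟩ := exists_of_isPullback (hF _ _ _ _ (fun _ _ h => h) (fun _ _ h => h)
    (isPullback_incl_inter S S')) hb.symm
  refine ⟨w, ?_⟩
  rw [← hw, ← PartOrd.comp_apply, ← F.map_comp]
  rfl

/-- For a finitary functor that preserves intersections, bases are finite and are bases. -/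
theorem finite_base {F : PartOrd.{u} ⥤ PartOrd.{u}}
    (hF : PreservesFilteredColimitsOfSize.{u, u} F) (hF' : PreservesIntersections F)
    {X : PartOrd.{u}} (α : F.obj X) :
    (base F α).Finite ∧ α ∈ Set.range (F.map (incl (base F α))) := by
  have hex : ∃ n, ∃ S : Set X, S.Finite ∧ α ∈ Set.range (F.map (incl S)) ∧ S.ncard = n := by
    obtain ⟨S, hS, hα⟩ := exists_finite_mem_range_map_incl hF α
    exact ⟨_, S, hS, hα, rfl⟩
  classical
  obtain ⟨S, hS, hα, hn⟩ := Nat.find_spec hex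
  -- `S` is a finite support of least cardinality. For any support `S'`, the set `S ∩ S'` is a
  -- finite support too, so minimality forces `S ⊆ S'`. Hence binary intersections suffice for the
  -- possibly infinite one that defines the base.
  have hbase : base F α = S := by
    refine Set.Subset.antisymm (Set.sInter_subset_of_mem hα) (Set.subset_sInter fun S' hS' => ?_)
    have hle := Nat.find_min' hex ⟨S ∩ S', hS.subset Set.inter_subset_left,
      mem_range_map_incl_inter hF' hα hS', rfl⟩
    rw [← hn] at hle
    exact Set.inter_eq_left.1 (Set.eq_of_subset_of_ncard_le Set.inter_subset_left hle hS)
  rw [hbase]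
  exact ⟨hS, hα⟩

theorem preservesFilteredColimits_dualFunctor {T : PartOrd.{u} ⥤ PartOrd.{u}}
    (hT : PreservesFilteredColimitsOfSize.{u, u} T) :
    PreservesFilteredColimitsOfSize.{u, u} (dualFunctor T) := by
  have : PartOrd.dual.{u}.IsEquivalence := PartOrd.dualEquiv.isEquivalence_functor
  refine ⟨fun J _ _ => ?_⟩
  have : PreservesColimitsOfShape J T :=
    PreservesFilteredColimitsOfSize.preserves_filtered_colimits J
  infer_instance

theorem preservesIntersections_dualFunctor {T : PartOrd.{u} ⥤ PartOrd.{u}}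
    (hT : PreservesIntersections T) : PreservesIntersections (dualFunctor T) := by
  have : PartOrd.dual.{u}.IsEquivalence := PartOrd.dualEquiv.isEquivalence_functor
  intro P A B C p q m n hm hn h
  exact (hT _ _ (PartOrd.dual.map m) (PartOrd.dual.map n) (fun a b hab => hm b a hab)
    (fun a b hab => hn b a hab) (h.map PartOrd.dual)).map PartOrd.dual

/-! ## The semantics of `Δ` -/

section Semantics

variable {T : PartOrd.{u} ⥤ PartOrd.{u}} {hT : Admissible T} {At X : PartOrd.{u}}
  {c : X ⟶ T.obj X} {v : MonRel At (PartOrd.dual.obj X)}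

theorem sat_delta_iff (x : X) (β : (dualFunctor T).obj (Lang hT At).carrier) :
    (sat hT c v).rel (OrderDual.toDual x) ((Lang hT At).delta β) ↔
      ¬ ((sat hT c v).neg.lift T).rel (T.map (dualDual X) (c x)) (OrderDual.ofDual β) :=
  (not_iff_comm.1 ((isSemantics_sat hT c v).delta x β)).symm

/-- The clause for `⋀` identifies `⊩` restricted along `⋀` with `all`, and lifting along `T^∂`
commutes with restriction. -/
theorem sat_nablaConj_iff (x : X) (Φ : (dualFunctor T).obj (Uω.obj (Lang hT At).carrier)) :
    (sat hT c v).rel (OrderDual.toDual x) (nablaConj hT At Φ) ↔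
      ((sat hT c v).all.lift (dualFunctor T)).rel
        (OrderDual.toDual (T.map (dualDual X) (c x))) Φ := by
  have e : (sat hT c v).restrict (Lang hT At).conj = (sat hT c v).all :=
    MonRel.ext (funext fun y => funext fun φ => propext
      ((isSemantics_sat hT c v).conj (OrderDual.ofDual y) φ))
  rw [← e]
  exact ((isSemantics_sat hT c v).nabla x _).trans
    (lift_restrict (preservesExactSquares_dualFunctor hT.exactSquares) _ _ _ _).symm

theorem sat_finDisj_iff (x : X) {s : Set (Lang hT At).carrier} (hs : s.Finite) :
    (sat hT c v).rel (OrderDual.toDual x) (finDisj hT s hs) ↔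
      ∃ a ∈ s, (sat hT c v).rel (OrderDual.toDual x) a := by
  refine ((isSemantics_sat hT c v).disj x _).trans ⟨?_, ?_⟩
  · rintro ⟨a, ⟨b, hb, hab⟩, ha⟩
    exact ⟨b, hb, (sat hT c v).mono le_rfl hab ha⟩
  · rintro ⟨a, ha, h⟩
    exact ⟨a, subset_lowerClosure ha, h⟩

theorem sat_delta_of_sat_nablaConj {x : X} {β : (dualFunctor T).obj (Lang hT At).carrier}
    {Φ : (dualFunctor T).obj (Uω.obj (Lang hT At).carrier)}
    (hΦ : (negLiftNotMem T (Lang hT At).carrier).rel Φ β)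
    (h : (sat hT c v).rel (OrderDual.toDual x) (nablaConj hT At Φ)) :
    (sat hT c v).rel (OrderDual.toDual x) ((Lang hT At).delta β) :=
  (sat_delta_iff x β).2
    (MonRel.not_lift_neg_of_lift_all hT.exactSquares _ ((sat_nablaConj_iff x Φ).1 h) hΦ)

/-- The finite support is taken to be the base of `β`, so that the witness lands in `L_β` and serves
both parts of the proposition. Finiteness of `L_β` plays no role here; it matters only for forming
the disjunction. -/
theorem exists_lColl_sat_nablaConj {x : X} {β : (dualFunctor T).obj (Lang hT At).carrier}
    (h : (sat hT c v).rel (OrderDual.toDual x) ((Lang hT At).delta β)) :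
    ∃ Φ ∈ LColl T β, (sat hT c v).rel (OrderDual.toDual x)
      (nablaConj hT At (baseIncl T β Φ)) := by
  obtain ⟨hfin, hβ⟩ := finite_base (preservesFilteredColimits_dualFunctor hT.finitary)
    (preservesIntersections_dualFunctor hT.intersections) β
  obtain ⟨Φ, h1, h2⟩ := MonRel.exists_lift_all_of_not_lift_neg hT.exactSquares (sat hT c v)
    (γ := OrderDual.toDual (T.map (dualDual X) (c x))) hfin hβ ((sat_delta_iff x β).1 h)
  exact ⟨Φ, h1, (sat_nablaConj_iff x _).2 h2⟩

theorem sat_delta_iff_exists (x : X) (β : (dualFunctor T).obj (Lang hT At).carrier) :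
    (sat hT c v).rel (OrderDual.toDual x) ((Lang hT At).delta β) ↔
      ∃ Φ : (dualFunctor T).obj (Uω.obj (Lang hT At).carrier),
        (negLiftNotMem T (Lang hT At).carrier).rel Φ β ∧
        (sat hT c v).rel (OrderDual.toDual x) (nablaConj hT At Φ) := by
  constructor
  · intro h
    obtain ⟨Φ, h1, h2⟩ := exists_lColl_sat_nablaConj h
    exact ⟨_, h1, h2⟩
  · rintro ⟨Φ, h1, h2⟩
    exact sat_delta_of_sat_nablaConj h1 h2

end Semantics

end MossLogic

end

/-! ### Equality of relations and the finite disjunction -/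

theorem mainTheorem4 (T : PartOrd.{u} ⥤ PartOrd.{u}) (hT : Admissible T)
    (At : PartOrd.{u}) :
    (∀ (X : PartOrd.{u}) (c : X ⟶ T.obj X) (v : MonRel At (PartOrd.dual.obj X)),
      (sat hT c v).restrict (Lang hT At).delta =
          ((sat hT c v).restrict (nablaConj hT At)).comp
            (negLiftNotMem T (Lang hT At).carrier) ∧
        ∀ (x : X) (β : (dualFunctor T).obj (Lang hT At).carrier),
          (sat hT c v).rel (OrderDual.toDual x) ((Lang hT At).delta β) ↔
            ∃ Φ : (dualFunctor T).obj
                (Uω.obj (Lang hT At).carrier),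
              (negLiftNotMem T (Lang hT At).carrier).rel Φ β ∧
              (sat hT c v).rel (OrderDual.toDual x) (nablaConj hT At Φ)) ∧
    ∀ (β : (dualFunctor T).obj (Lang hT At).carrier)
      (hβ : (LColl T β).Finite),
      SemEquiv hT ((Lang hT At).delta β)
        (finDisj hT
          ((fun Φ => nablaConj hT At (baseIncl T β Φ)) '' LColl T β)
          (hβ.image _)) := by
  refine ⟨fun X c v => ⟨MonRel.ext (funext fun y => funext fun β => propext ?_),
    sat_delta_iff_exists⟩, fun β hβ => ⟨fun X c v x h => ?_, fun X c v x h => ?_⟩⟩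
  -- Composition of relations lists the condition on `∇` before the one on `β`, hence the swap.
  · exact (sat_delta_iff_exists (c := c) (v := v) (OrderDual.ofDual y) β).trans
      (exists_congr fun Φ => and_comm)
  · obtain ⟨Φ, h1, h2⟩ := exists_lColl_sat_nablaConj h
    exact (sat_finDisj_iff x _).2 ⟨_, ⟨Φ, h1, rfl⟩, h2⟩
  · obtain ⟨_, ⟨Φ, h1, rfl⟩, h2⟩ := (sat_finDisj_iff x _).1 h
    exact sat_delta_of_sat_nablaConj h1 h2
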